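/- Let $\mathcal X$ be a feature space and $\mathcal Y=\{-1,+1\}$. A manipulation graph $G$ is a directed graph on $\mathcal X$; write $N_G[x]=\{x\}\cup\{x' : (x,x')\text{ is an edge}\}$. For a classifier $h:\mathcal X\to\mathcal Y$ put $\mathrm{BR}_{G,h}(x)=\{x'\in N_G[x] : h(x')=+1\}$. An agent $(x,y)\in\mathcal X\times\mathcal Y$ facing $h$ reports the feature vector $z=z(h,x)$, where $z=x$ if $\mathrm{BR}_{G,h}(x)=\emptyset$ or $x\in\mathrm{BR}_{G,h}(x)$, and otherwise $z\in\mathrm{BR}_{G,h}(x)$ is chosen by a fixed tie-breaking rule. The strategic loss is $\ell_G^{\mathrm{str}}(h,(x,y))=\mathbf 1\{h(z(h,x))\neq y\}$. In each round $t=1,\dots,T$, a learner selects a distribution $\mathcal D_t$ on classifiers, as a function of its past observations $(h_s,z_s,y_s)_{s<t}$ (post-manipulation feedback); simultaneously an adaptive adversary, who knows the learner's algorithm, selects an agent $(x_t,y_t)$, possibly at random, depending on the whole past $(h_s,x_s,y_s)_{s<t}$. Then $h_t\sim\mathcal D_t$ is sampled, independently of $(x_t,y_t)$ given the past, and the learner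 observes $z_t=z(h_t,x_t)$ and $y_t$. The learner is proper for a class $\mathcal H$ if $\mathcal D_t$ is always supported on $\mathcal H$. The expected Stackelberg regret is \[ \mathbb E[\mathfrak R_T]=\max_{h\in\mathcal H}\sum_{t=1}^T\mathbb E\left[\ell_G^{\mathrm{str}}(h_t,(x_t,y_t))-\ell_G^{\mathrm{str}}(h,(x_t,y_t))\right]. \] There is a universal constant $C>0$ such that for every manipulation graph $G$, every finite non-empty class $\mathcal H\subseteq\mathcal Y^{\mathcal X}$ of size $n$ and every $T\ge 1$, there is a proper randomized learner (which may depend on $G$, $\mathcal H$ and $T$) that guarantees, for every tie-breaking rule and against every adaptive adversary, \[ \mathbb E[\mathfrak R_T]\le C\,\min\left\{\sqrt{T\log n}+n\log(nT),\ \sqrt{T\,n\log n}\right\}. \] -/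

import Mathlib

namespace StrategicOnline

/-- The label space `{-1, +1}`. -/
abbrev Label : Type := ℤˣ

/-- An agent `(x, y)`: a feature vector and its true label. -/
abbrev Agent (X : Type*) : Type _ := X × Label

/-- The closed neighbourhood `N_G[x] = {x} ∪ {x' | (x, x') is an edge}` in the (directed)
manipulation graph `G`; undirected graphs are the symmetric ones. -/
def closedNbhd {X : Type*} (G : Digraph X) (x : X) : Set X :=
  {x' | x' = x ∨ G.Adj x x'}

/-- The set of best responses of `x` under the classifier `h`. -/
def bestResponses {X : Type*} (G : Digraph X) (h : X → Label) (x : X) : Set X :=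
  {x' | x' ∈ closedNbhd G x ∧ h x' = 1}

/-- `z h x` is the manipulated feature vector of an agent at `x` facing `h`: the agent stays if it
has no best response or is itself a best response, and otherwise moves to a best response. Such a
function `z` is a fixed tie-breaking rule. -/
def IsManipulationRule {X : Type*} (G : Digraph X) (z : (X → Label) → X → X) : Prop :=
  ∀ (h : X → Label) (x : X),
    ((bestResponses G h x = ∅ ∨ x ∈ bestResponses G h x) → z h x = x) ∧
    (¬ (bestResponses G h x = ∅ ∨ x ∈ bestResponses G h x) → z h x ∈ bestResponses G h x)

/-- The strategic loss `1{h(z) ≠ y}` of `h` at the agent `(x, y)`, where `z` is the manipulated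
feature vector. -/
def strategicLoss {X : Type*} (z : (X → Label) → X → X) (h : X → Label) (a : Agent X) : ℝ :=
  if h (z h a.1) ≠ a.2 then 1 else 0

/-- What happens in one round: the classifier sampled by the learner and the agent. -/
structure Round (X : Type*) where
  classifier : X → Label
  agent : Agent X

/-- What the learner sees of one round: its own sampled classifier, the manipulated feature vector
and the true label. -/
structure Observation (X : Type*) where
  classifier : X → Label
  feature : X
  label : Label

/-- Post-manipulation feedback. -/
def Round.observe {X : Type*} (z : (X → Label) → X → X) (r : Round X) : Observation X where
  classifier := r.classifier
  feature := z r.classifier r.agent.1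
  label := r.agent.2

/-- A randomized learner: from the observations of the past rounds (most recent first) it computes
the distribution from which the next classifier is sampled. -/
abbrev Learner (X : Type*) : Type _ := List (Observation X) → PMF (X → Label)

/-- The learner only ever plays classifiers of the class `H`. -/
def Learner.IsProper {X : Type*} (L : Learner X) (H : Finset (X → Label)) : Prop :=
  ∀ o : List (Observation X), (L o).support ⊆ (H : Set (X → Label))

/-- An adaptive adversary, possibly randomized: from the complete past (most recent round first) it
computes the distribution of the next agent. It does not see the classifier sampled in the current
round. (As it may depend on the learner, it may use the learner's current distribution, which is a
function of the past; deterministic adversaries are those with values `PMF.pure _`.) -/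
abbrev Adversary (X : Type*) : Type _ := List (Round X) → PMF (Agent X)

/-- The law of the next round after the past `past`: the agent and the classifier are chosen
simultaneously, i.e. independently given the past. -/
noncomputable def nextRound {X : Type*} (z : (X → Label) → X → X) (L : Learner X)
    (A : Adversary X) (past : List (Round X)) : PMF (Round X) :=
  (A past).bind fun a => (L (past.map (Round.observe z))).map fun h => ⟨h, a⟩

/-- The law of the first `t` rounds, listed with the most recent round first. -/
noncomputable def historyLaw {X : Type*} (z : (X → Label) → X → X) (L : Learner X)
    (A : Adversary X) : ℕ → PMF (List (Round X))
  | 0 => PMF.pure []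
  | t + 1 => (historyLaw z L A t).bind fun past =>
      (nextRound z L A past).map fun r => r :: past

/-- The law of the round that is played after `t` earlier rounds. -/
noncomputable def roundLaw {X : Type*} (z : (X → Label) → X → X) (L : Learner X)
    (A : Adversary X) (t : ℕ) : PMF (Round X) :=
  (historyLaw z L A t).bind (nextRound z L A)

/-- The expectation of a real function under a discrete distribution. -/
noncomputable def expectation {α : Type*} (p : PMF α) (f : α → ℝ) : ℝ :=
  ∑' a, (p a).toReal * f a

/-- The series defining the expectation of a bounded function converges. -/
theorem summable_expectation {α : Type*} (p : PMF α) (f : α → ℝ) (B : ℝ)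
    (hf : ∀ a, |f a| ≤ B) : Summable fun a => (p a).toReal * f a := by
  have hp : Summable fun a => (p a).toReal := ENNReal.summable_toReal p.tsum_coe_ne_top
  refine Summable.of_norm_bounded (hp.mul_right B) fun a => ?_
  rw [Real.norm_eq_abs, abs_mul, abs_of_nonneg ENNReal.toReal_nonneg]
  exact mul_le_mul_of_nonneg_left (hf a) ENNReal.toReal_nonneg

/-- The expected Stackelberg regret over `T` rounds,
`max_{h ∈ H} ∑_t E[ℓ(h_t, (x_t, y_t)) - ℓ(h, (x_t, y_t))]`. -/
noncomputable def expectedRegret {X : Type*} (z : (X → Label) → X → X) (H : Finset (X → Label))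
    (hH : H.Nonempty) (L : Learner X) (A : Adversary X) (T : ℕ) : ℝ :=
  H.sup' hH fun h => ∑ t ∈ Finset.range T,
    expectation (roundLaw z L A t) fun r =>
      strategicLoss z r.classifier r.agent - strategicLoss z h r.agent

end StrategicOnline

/-! After manipulation, `h` labels an agent at `x` negative exactly when it has no best response
there; call this rejection. Up to a term depending only on `y`, the loss is the negative of the gain
`-y * rejection`, so all rejecting classifiers share one gain `s = ±1` and the others have gain 0.
If the sampled classifier rejects, the agent has not moved: `x` is seen and every classifier can be
evaluated. If it accepts, `x` may be hidden, and the estimate is set to 0. Dividing by the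
probability `q` of rejection makes the estimates unbiased, with second moment `∑ p g²` at most 1 in
expectation, without a factor `n`.

The obstacle is that an estimate can be as large as `1 / q`, while the entropic analysis needs `η g
≤ 1`. There are two remedies (`mul_sub_sub_hybridDiv_le`). A logarithmic barrier needs only `p g ≤
1`, which always holds, and costs `n log (1/ε)`. Alternatively all weights are kept at least `η`,
which costs order `T n η`. Both are covered by `exists_learner_expectedRegret_le`, whose potential
is the divergence from a smoothed comparator; tuning the parameters gives the two terms of the
minimum. -/

namespace StrategicOnline

/-! ### Mirror descent with negative entropy plus a logarithmic barrier. -/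

section MirrorDescent

variable {ι : Type*} [Fintype ι]

/-- The probability vectors with all coordinates at least `ε`. -/
def truncatedSimplex (ι : Type*) [Fintype ι] (ε : ℝ) : Set (ι → ℝ) :=
  {p | (∀ i, ε ≤ p i) ∧ ∑ i, p i = 1}

/-- The Bregman divergence on `(0, ∞)` of `x log x / η - c log x`. -/
noncomputable def hybridDiv (η c x y : ℝ) : ℝ :=
  (x * Real.log (x / y) - x + y) / η + c * (x / y - 1 - Real.log (x / y))

/-- The Bregman divergence of the hybrid of negative entropy and logarithmic barrier. -/
noncomputable def hybridDivergence (η c : ℝ) (p q : ι → ℝ) : ℝ :=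
  ∑ i, hybridDiv η c (p i) (q i)

/-- The three-point identity of Bregman divergences: the factor on the left is the derivative of the
divergence from `p` at `q`. It turns first-order optimality into the telescoping bound. -/
theorem hybridDiv_three_point {η c u p q : ℝ} (hu : 0 < u) (hp : 0 < p) (hq : 0 < q) :
    (Real.log (q / p) / η + c * (1 / p - 1 / q)) * (u - q) =
      hybridDiv η c u p - hybridDiv η c u q - hybridDiv η c q p := by
  unfold hybridDiv
  rw [Real.log_div hu.ne' hp.ne', Real.log_div hu.ne' hq.ne', Real.log_div hq.ne' hp.ne']
  have e1 : c * (1 / p - 1 / q) * (u - q) = c * (u / p - u / q - q / p + 1) := by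
    field_simp
    ring
  rw [add_mul, e1]
  ring

theorem hasDerivAt_hybridDiv {η c p q : ℝ} (hp : 0 < p) (hq : 0 < q) :
    HasDerivAt (fun x => hybridDiv η c x p) (Real.log (q / p) / η + c * (1 / p - 1 / q)) q := by
  have hd : HasDerivAt (fun x : ℝ => x / p) (1 / p) q := (hasDerivAt_id q).div_const p
  have hl : HasDerivAt (fun x : ℝ => Real.log (x / p)) (1 / p / (q / p)) q :=
    hd.log (by positivity)
  have h1 := ((((hasDerivAt_id q).mul hl).sub (hasDerivAt_id q)).add_const p).div_const η
  have h2 := ((hd.sub_const 1).sub hl).const_mul c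
  refine (h1.add h2).congr_deriv ?_
  simp only [id]
  have e1 : 1 / p / (q / p) = 1 / q := by field_simp
  have e2 : q * (1 / q) = 1 := by field_simp
  rw [e1, e2]
  ring

theorem convex_truncatedSimplex (ε : ℝ) : Convex ℝ (truncatedSimplex ι ε) := by
  intro p hp q hq a b ha hb hab
  refine ⟨fun i => ?_, ?_⟩
  · simp only [Pi.add_apply, Pi.smul_apply, smul_eq_mul]
    have h1 := mul_le_mul_of_nonneg_left (hp.1 i) ha
    have h2 := mul_le_mul_of_nonneg_left (hq.1 i) hb
    have h3 : a * ε + b * ε = ε := by rw [← add_mul, hab, one_mul]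
    linarith
  · simp only [Pi.add_apply, Pi.smul_apply, smul_eq_mul, Finset.sum_add_distrib,
      ← Finset.mul_sum, hp.2, hq.2]
    linarith

theorem le_one_of_mem_truncatedSimplex {ε : ℝ} (hε : 0 ≤ ε) {p : ι → ℝ}
    (hp : p ∈ truncatedSimplex ι ε) (i : ι) : p i ≤ 1 := by
  rw [← hp.2]
  exact Finset.single_le_sum (fun j _ => hε.trans (hp.1 j)) (Finset.mem_univ i)

theorem isCompact_truncatedSimplex {ε : ℝ} (hε : 0 ≤ ε) : IsCompact (truncatedSimplex ι ε) := by
  refine (isCompact_univ_pi fun _ : ι => isCompact_Icc (a := ε) (b := 1)).of_isClosed_subset ?_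
    fun p hp i _ => ⟨hp.1 i, le_one_of_mem_truncatedSimplex hε hp i⟩
  have h : truncatedSimplex ι ε = (⋂ i, {p : ι → ℝ | ε ≤ p i}) ∩ {p | ∑ i, p i = 1} := by
    ext p
    simp [truncatedSimplex]
  rw [h]
  exact (isClosed_iInter fun i => isClosed_le continuous_const (continuous_apply i)).inter
    (isClosed_eq (by fun_prop) continuous_const)

/-- Existence of a mirror descent step with its variational inequality. -/
theorem exists_mirrorStep {ε : ℝ} (hε : 0 < ε) (η c : ℝ) (p : truncatedSimplex ι ε) (g : ι → ℝ) :
    ∃ p' : truncatedSimplex ι ε, ∀ u ∈ truncatedSimplex ι ε,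
      ∑ i, g i * (u i - p'.1 i) ≤
        hybridDivergence η c u p.1 - hybridDivergence η c u p'.1 -
          hybridDivergence η c p'.1 p.1 := by
  set f : (ι → ℝ) → ℝ := fun q => ∑ i, (hybridDiv η c (q i) (p.1 i) - g i * q i)
  have pos : ∀ q ∈ truncatedSimplex ι ε, ∀ i, 0 < q i := fun q hq i => hε.trans_le (hq.1 i)
  let D : (ι → ℝ) → ι → ℝ := fun q i =>
    Real.log (q i / p.1 i) / η + c * (1 / p.1 i - 1 / q i) - g i
  have hderiv : ∀ q ∈ truncatedSimplex ι ε, HasFDerivAt f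
      (∑ i, D q i • (ContinuousLinearMap.proj (R := ℝ) (φ := fun _ : ι => ℝ) i)) q := by
    intro q hq
    refine HasFDerivAt.fun_sum fun i _ => ?_
    have h1 : HasDerivAt (fun x => hybridDiv η c x (p.1 i) - g i * x) (D q i) (q i) := by
      have h2 := (hasDerivAt_id (q i)).const_mul (g i)
      rw [mul_one] at h2
      exact (hasDerivAt_hybridDiv (pos _ p.2 i) (pos q hq i)).sub h2
    exact h1.comp_hasFDerivAt q
      (ContinuousLinearMap.proj (R := ℝ) (φ := fun _ : ι => ℝ) i).hasFDerivAt
  obtain ⟨p', hp', hmin⟩ := (isCompact_truncatedSimplex (ι := ι) hε.le).exists_isMinOn ⟨p.1, p.2⟩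
    (f := f) fun q hq => (hderiv q hq).continuousAt.continuousWithinAt
  refine ⟨⟨p', hp'⟩, fun u hu => ?_⟩
  -- First-order optimality on a convex set: the derivative at the minimizer is nonnegative in the
  -- direction `u - p'`.
  have h0 := hmin.localize.hasFDerivWithinAt_nonneg (hderiv p' hp').hasFDerivWithinAt
    (sub_mem_posTangentConeAt_of_segment_subset
      ((convex_truncatedSimplex ε).segment_subset hp' hu))
  simp only [sum_apply, smul_apply,
    ContinuousLinearMap.proj_apply, Pi.sub_apply, smul_eq_mul] at h0
  unfold hybridDivergence
  rw [← Finset.sum_sub_distrib, ← Finset.sum_sub_distrib, ← sub_nonneg, ← Finset.sum_sub_distrib]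
  refine h0.trans_eq (Finset.sum_congr rfl fun i _ => ?_)
  rw [← hybridDiv_three_point (pos u hu i) (pos _ p.2 i) (pos p' hp' i), ← sub_mul]

theorem sub_one_sub_log_nonneg {u : ℝ} (hu : 0 < u) : 0 ≤ u - 1 - Real.log u := by
  linarith [Real.log_le_sub_one_of_pos hu]

theorem entropyDiv_nonneg {x y : ℝ} (hx : 0 < x) (hy : 0 < y) :
    0 ≤ x * Real.log (x / y) - x + y := by
  have h := Real.log_le_sub_one_of_pos (div_pos hy hx)
  have h1 : x * Real.log (y / x) ≤ x * (y / x - 1) := mul_le_mul_of_nonneg_left h hx.le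
  have h2 : x * (y / x - 1) = y - x := by field_simp
  rw [Real.log_div hy.ne' hx.ne'] at h1
  rw [Real.log_div hx.ne' hy.ne']
  linarith

theorem hybridDiv_nonneg {η c x y : ℝ} (hη : 0 < η) (hc : 0 ≤ c) (hx : 0 < x) (hy : 0 < y) :
    0 ≤ hybridDiv η c x y :=
  add_nonneg (div_nonneg (entropyDiv_nonneg hx hy) hη.le)
    (mul_nonneg hc (sub_one_sub_log_nonneg (div_pos hx hy)))

theorem exp_le_one_add_add_sq {v : ℝ} (hv : v ≤ 1) : Real.exp v ≤ 1 + v + v ^ 2 := by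
  rcases le_or_gt (-1) v with h | h
  · have := (abs_le.1 (Real.abs_exp_sub_one_sub_id_le (abs_le.2 ⟨h, hv⟩))).2
    linarith
  · have := Real.exp_le_one_iff.2 (by linarith : v ≤ 0)
    nlinarith

/-- The stability of the hybrid regularizer, in one coordinate. -/
theorem mul_sub_sub_hybridDiv_le {η c x y g : ℝ} (hη : 0 < η) (hc : 0 ≤ c) (hx : 0 < x)
    (hy : 0 < y) (hyg : y * g ≤ 1) (h : 2 ≤ c ∨ η * g ≤ 1) :
    g * (x - y) - hybridDiv η c x y ≤ η * (y * g ^ 2) := by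
  have hent := entropyDiv_nonneg hx hy
  have hbar := sub_one_sub_log_nonneg (div_pos hx hy)
  unfold hybridDiv
  rcases le_or_gt (η * g) 1 with h1 | h1
  · have hw : 0 < y * Real.exp (η * g) / x := by positivity
    have h2 := mul_le_mul_of_nonneg_left (Real.log_le_sub_one_of_pos hw) hx.le
    rw [Real.log_div (by positivity) hx.ne', Real.log_mul hy.ne' (Real.exp_pos _).ne',
      Real.log_exp] at h2
    have h3 : x * (y * Real.exp (η * g) / x - 1) = y * Real.exp (η * g) - x := by field_simp
    have h4 := mul_le_mul_of_nonneg_left (exp_le_one_add_add_sq h1) hy.le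
    have h5 : 0 ≤ c * (x / y - 1 - Real.log (x / y)) := mul_nonneg hc hbar
    have h6 : g * (x - y) - η * (y * g ^ 2) ≤ (x * Real.log (x / y) - x + y) / η := by
      rw [le_div_iff₀ hη, Real.log_div hx.ne' hy.ne']
      nlinarith
    linarith
  -- For a large gain the entropy is dropped instead, and the barrier pays. The target `y * g`
  -- suffices because `η * g > 1`.
  · have hc2 : 2 ≤ c := h.resolve_right (not_le.2 h1)
    have hg : 0 < g := pos_of_mul_pos_right (one_pos.trans h1) hη.le
    have h5 : 2 * (x / y - 1 - Real.log (x / y)) ≤ c * (x / y - 1 - Real.log (x / y)) :=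
      mul_le_mul_of_nonneg_right hc2 hbar
    have h6 : 0 ≤ (x * Real.log (x / y) - x + y) / η := div_nonneg hent hη.le
    have h7 : y * g ≤ η * (y * g ^ 2) := by
      have : 0 < y * g := mul_pos hy hg
      nlinarith
    have h8 : g * (x - y) = (y * g) * (x / y - 1) := by field_simp
    have hu : 0 < x / y := div_pos hx hy
    have h9 : Real.log (x / y) ≤ x / y / 2 := by
      have a1 := Real.log_le_sub_one_of_pos (half_pos hu)
      rw [Real.log_div hu.ne' two_ne_zero] at a1
      linarith [Real.log_two_lt_d9]
    have h10 : (y * g) * (x / y - 1) - 2 * (x / y - 1 - Real.log (x / y)) ≤ y * g := by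
      have : 0 < y * g := mul_pos hy hg
      -- With `u = x / y` the claim is `y g (u - 2) ≤ 2 (u - 1 - log u)`. For `u ≤ 2` the left side
      -- is nonpositive; otherwise use `y g ≤ 1` and `log u ≤ u / 2`.
      rcases le_or_gt (x / y) 2 with h2 | h2
      · nlinarith
      · nlinarith
    linarith

theorem sum_mul_sub_le_of_step {ε η c : ℝ} (hε : 0 < ε) (hη : 0 < η) (hc : 0 ≤ c)
    {p p' u g : ι → ℝ} (hp : p ∈ truncatedSimplex ι ε) (hp' : p' ∈ truncatedSimplex ι ε)
    (hstep : ∑ i, g i * (u i - p' i) ≤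
      hybridDivergence η c u p - hybridDivergence η c u p' - hybridDivergence η c p' p)
    (hg : ∀ i, p i * g i ≤ 1) (h : ∀ i, 2 ≤ c ∨ η * g i ≤ 1) :
    ∑ i, g i * (u i - p i) ≤
      hybridDivergence η c u p - hybridDivergence η c u p' + η * ∑ i, p i * g i ^ 2 := by
  have h1 : ∑ i, g i * (p' i - p i) - hybridDivergence η c p' p ≤ η * ∑ i, p i * g i ^ 2 := by
    unfold hybridDivergence
    rw [← Finset.sum_sub_distrib, Finset.mul_sum]
    exact Finset.sum_le_sum fun i _ => mul_sub_sub_hybridDiv_le hη hc (hε.trans_le (hp'.1 i))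
      (hε.trans_le (hp.1 i)) (hg i) (h i)
  have h2 : ∑ i, g i * (u i - p i) = ∑ i, g i * (u i - p' i) + ∑ i, g i * (p' i - p i) := by
    rw [← Finset.sum_add_distrib]
    exact Finset.sum_congr rfl fun i _ => by ring
  linarith

/-- Compactness of the truncated simplex makes the potential bounded, so that its expectations over
infinite history spaces converge. -/
theorem abs_hybridDivergence_le {ε η c : ℝ} (hε : 0 < ε) {u : ι → ℝ}
    (hu : u ∈ truncatedSimplex ι ε) :
    ∃ B, ∀ p : truncatedSimplex ι ε, |hybridDivergence η c u p| ≤ B := by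
  have hcont : ContinuousOn (fun p => hybridDivergence η c u p) (truncatedSimplex ι ε) := by
    unfold hybridDivergence hybridDiv
    refine continuousOn_finsetSum _ fun i _ => ?_
    have hdiv : ContinuousOn (fun p : ι → ℝ => u i / p i) (truncatedSimplex ι ε) :=
      continuousOn_const.div (continuous_apply i).continuousOn
        fun p hp => (hε.trans_le (hp.1 i)).ne'
    have hlog : ContinuousOn (fun p : ι → ℝ => Real.log (u i / p i)) (truncatedSimplex ι ε) :=
      hdiv.log fun p hp => (div_pos (hε.trans_le (hu.1 i)) (hε.trans_le (hp.1 i))).ne'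
    exact ((((continuousOn_const.mul hlog).sub continuousOn_const).add
      (continuous_apply i).continuousOn).div_const η).add
      (continuousOn_const.mul ((hdiv.sub continuousOn_const).sub hlog))
  obtain ⟨B, hB⟩ := (isCompact_truncatedSimplex hε.le).exists_bound_of_continuousOn hcont
  exact ⟨B, fun p => hB p p.2⟩

theorem uniform_mem_truncatedSimplex [Nonempty ι] {ε : ℝ} (h : Fintype.card ι * ε ≤ 1) :
    (fun _ => 1 / (Fintype.card ι : ℝ)) ∈ truncatedSimplex ι ε := by
  have : (0 : ℝ) < Fintype.card ι := by exact_mod_cast Fintype.card_pos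
  refine ⟨fun i => ?_, ?_⟩
  · rw [le_div_iff₀ this]
    linarith
  · simp [this.ne']

theorem hybridDivergence_uniform_le [Nonempty ι] {ε η c : ℝ} (hε : 0 < ε) (hη : 0 < η)
    (hc : 0 ≤ c) {u : ι → ℝ} (hu : u ∈ truncatedSimplex ι ε) :
    hybridDivergence η c u (fun _ => 1 / (Fintype.card ι : ℝ)) ≤
      Real.log (Fintype.card ι) / η + c * (Fintype.card ι * Real.log (1 / ε)) := by
  set n := (Fintype.card ι : ℝ) with hn
  have hn1 : 1 ≤ n := Nat.one_le_cast.2 (Fintype.card_pos (α := ι))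
  have hn0 : 0 < n := by linarith
  have key : ∀ i, hybridDiv η c (u i) (1 / n) ≤
      (u i * Real.log n - u i + 1 / n) / η + c * (u i * n - 1 + Real.log (1 / ε)) := by
    intro i
    have hui : 0 < u i := hε.trans_le (hu.1 i)
    have e : u i / (1 / n) = u i * n := by field_simp
    have l1 : Real.log (u i) ≤ 0 :=
      Real.log_nonpos hui.le (le_one_of_mem_truncatedSimplex hε.le hu i)
    have l2 : Real.log ε ≤ Real.log (u i) := Real.log_le_log hε (hu.1 i)
    have l3 : 0 ≤ Real.log n := Real.log_nonneg hn1
    unfold hybridDiv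
    rw [e, Real.log_mul hui.ne' hn0.ne', one_div ε, Real.log_inv]
    refine add_le_add (div_le_div_of_nonneg_right ?_ hη.le) (mul_le_mul_of_nonneg_left ?_ hc)
    · nlinarith
    · linarith
  refine (Finset.sum_le_sum fun i _ => key i).trans_eq ?_
  rw [Finset.sum_add_distrib, ← Finset.sum_div, ← Finset.mul_sum]
  simp only [Finset.sum_add_distrib, Finset.sum_sub_distrib, ← Finset.sum_mul, hu.2,
    Finset.sum_const, Finset.card_univ, nsmul_eq_mul, ← hn]
  have : n * (1 / n) = 1 := by field_simp
  rw [this]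
  ring

/-- The vertex `h` of the simplex, moved into the truncated simplex. -/
noncomputable def truncatedVertex [DecidableEq ι] (ε : ℝ) (h : ι) : ι → ℝ :=
  fun i => (if i = h then 1 - Fintype.card ι * ε else 0) + ε

theorem truncatedVertex_mem [DecidableEq ι] {ε : ℝ} (h : Fintype.card ι * ε ≤ 1) (k : ι) :
    truncatedVertex ε k ∈ truncatedSimplex ι ε := by
  refine ⟨fun i => ?_, ?_⟩
  · unfold truncatedVertex
    split_ifs <;> linarith
  · simp [truncatedVertex, Finset.sum_add_distrib]

/-- The price, per round, of comparing with an interior point rather than a vertex, at which the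
barrier would be infinite. -/
theorem sub_sum_mul_truncatedVertex_le [DecidableEq ι] {ε : ℝ} (hε : 0 ≤ ε) (k : ι) {g : ι → ℝ}
    (hg : ∀ i, |g i| ≤ 1) :
    g k - ∑ i, g i * truncatedVertex ε k i ≤ 2 * (Fintype.card ι * ε) := by
  have h1 : ∑ i, g i * truncatedVertex ε k i =
      g k * (1 - Fintype.card ι * ε) + (∑ i, g i) * ε := by
    simp [truncatedVertex, mul_add, Finset.sum_add_distrib, Finset.sum_mul]
  have h2 : -(Fintype.card ι : ℝ) ≤ ∑ i, g i := by
    have := Finset.sum_le_sum (s := Finset.univ) fun i _ => (abs_le.1 (hg i)).1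
    simpa using this
  have h3 := mul_le_mul_of_nonneg_right h2 hε
  have h4 : 0 ≤ (Fintype.card ι : ℝ) * ε := by positivity
  have h5 := mul_le_mul_of_nonneg_right (abs_le.1 (hg k)).2 h4
  rw [h1]
  nlinarith

/-- A mirror descent step for the gain vector `g`. -/
noncomputable def mirrorStep {ε : ℝ} (hε : 0 < ε) (η c : ℝ) (p : truncatedSimplex ι ε)
    (g : ι → ℝ) : truncatedSimplex ι ε :=
  (exists_mirrorStep hε η c p g).choose

/-- Mirror descent with importance weighted gains: the gain `s` of the arms with `a = 1` is
revealed exactly when such an arm is drawn. -/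
theorem expected_mirrorStep_le [DecidableEq ι] {ε η c : ℝ} (hε : 0 < ε) (hη : 0 < η) (hc : 0 ≤ c)
    (hpar : 2 ≤ c ∨ η ≤ ε) (hn : Fintype.card ι * ε ≤ 1) (p : truncatedSimplex ι ε) (k₀ : ι)
    {a : ι → ℝ} (ha : ∀ i, a i = 0 ∨ a i = 1) {s : ℝ} (hs : |s| ≤ 1) {q : ℝ}
    (hq : q = ∑ i, p.1 i * a i) (g : ι → ι → ℝ) (hg : ∀ k i, g k i = a k * (a i * (s / q))) :
    s * a k₀ - ∑ k, p.1 k * (s * a k) +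
        ∑ k, p.1 k * hybridDivergence η c (truncatedVertex ε k₀) (mirrorStep hε η c p (g k)) ≤
      hybridDivergence η c (truncatedVertex ε k₀) p + (η + 2 * (Fintype.card ι * ε)) := by
  set u := truncatedVertex ε k₀
  have hp : ∀ i, 0 < p.1 i := fun i => hε.trans_le (p.2.1 i)
  have ha0 : ∀ i, 0 ≤ a i := fun i => by rcases ha i with h | h <;> norm_num [h]
  have ha1 : ∀ i, a i ≤ 1 := fun i => by rcases ha i with h | h <;> norm_num [h]
  have haa : ∀ i, a i ^ 2 = a i := fun i => by rcases ha i with h | h <;> norm_num [h]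
  have hle : ∀ i, p.1 i * a i ≤ q := fun i => by
    rw [hq]
    exact Finset.single_le_sum (fun j _ => mul_nonneg (hp j).le (ha0 j)) (Finset.mem_univ i)
  have hq0 : 0 ≤ q := by
    rw [hq]
    exact Finset.sum_nonneg fun j _ => mul_nonneg (hp j).le (ha0 j)
  -- If `q = 0`, all `a i` vanish because the weights are positive, so division by zero is harmless.
  have haq : ∀ i, a i * (q / q) = a i := fun i => by
    rcases ha i with h | h
    · rw [h, zero_mul]
    · have : 0 < q := lt_of_lt_of_le (by rw [h, mul_one]; exact hp i) (hle i)
      rw [div_self this.ne', mul_one]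
  have hsle := abs_le.1 hs
  have hgle : ∀ k i, g k i ≤ a i / q := fun k i => by
    have h0 : 0 ≤ a i / q := div_nonneg (ha0 i) hq0
    have h1 : a k * s ≤ 1 := by nlinarith [ha0 k, ha1 k]
    calc g k i = (a k * s) * (a i / q) := by rw [hg]; ring
      _ ≤ 1 * (a i / q) := mul_le_mul_of_nonneg_right h1 h0
      _ = a i / q := one_mul _
  have hstep : ∀ k, ∑ i, g k i * (u i - p.1 i) ≤ hybridDivergence η c u p -
      hybridDivergence η c u (mirrorStep hε η c p (g k)) + η * ∑ i, p.1 i * g k i ^ 2 := by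
    intro k
    refine sum_mul_sub_le_of_step hε hη hc p.2 (mirrorStep hε η c p (g k)).2
      ((exists_mirrorStep hε η c p (g k)).choose_spec u (truncatedVertex_mem hn k₀))
      (fun i => ?_) fun i => hpar.imp_right fun h => ?_
    · calc p.1 i * g k i ≤ p.1 i * (a i / q) := mul_le_mul_of_nonneg_left (hgle k i) (hp i).le
        _ = p.1 i * a i / q := by ring
        _ ≤ 1 := div_le_one_of_le₀ (hle i) hq0
    · calc η * g k i ≤ η * (a i / q) := mul_le_mul_of_nonneg_left (hgle k i) hη.le
        _ = η * a i / q := by ring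
        _ ≤ 1 := div_le_one_of_le₀
          ((mul_le_mul_of_nonneg_right (h.trans (p.2.1 i)) (ha0 i)).trans (hle i)) hq0
  have hsum := Finset.sum_le_sum (s := Finset.univ) fun k _ =>
    mul_le_mul_of_nonneg_left (hstep k) (hp k).le
  -- Unbiasedness: averaging over the drawn arm `k` cancels the factor `1 / q`.
  have hleft : ∑ k, p.1 k * ∑ i, g k i * (u i - p.1 i) =
      ∑ i, s * a i * u i - ∑ i, p.1 i * (s * a i) := by
    have e1 : ∀ k, p.1 k * ∑ i, g k i * (u i - p.1 i) =
        (p.1 k * a k) * ∑ i, a i * (s / q) * (u i - p.1 i) := fun k => by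
      simp only [hg, mul_assoc, ← Finset.mul_sum]
    simp only [e1]
    rw [← Finset.sum_mul, ← hq, Finset.mul_sum, ← Finset.sum_sub_distrib]
    refine Finset.sum_congr rfl fun i _ => ?_
    calc q * (a i * (s / q) * (u i - p.1 i)) = s * (a i * (q / q)) * (u i - p.1 i) := by ring
      _ = _ := by rw [haq]; ring
  -- One factor `q` comes from the draw and one from `∑ p a² = q`; they cancel `1 / q²`.
  have hvar : ∑ k, p.1 k * ∑ i, p.1 i * g k i ^ 2 ≤ 1 := by
    have e1 : ∀ k, p.1 k * ∑ i, p.1 i * g k i ^ 2 = (p.1 k * a k) * (q * (s / q) ^ 2) := by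
      intro k
      rw [mul_assoc, hq, Finset.sum_mul, ← hq, ← haa k, Finset.mul_sum (a := a k ^ 2)]
      congr 1
      refine Finset.sum_congr rfl fun i _ => ?_
      rw [hg, mul_pow, mul_pow, haa i]
      ring
    simp only [e1]
    rw [← Finset.sum_mul, ← hq]
    have h1 : s ^ 2 ≤ 1 := (sq_le_one_iff_abs_le_one s).2 hs
    have h2 : q / q ≤ 1 := div_self_le_one q
    have h3 : 0 ≤ q / q := div_nonneg hq0 hq0
    calc q * (q * (s / q) ^ 2) = s ^ 2 * (q / q) ^ 2 := by ring
      _ ≤ 1 := mul_le_one₀ h1 (sq_nonneg _) (pow_le_one₀ h3 h2)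
  have hcomp : s * a k₀ - ∑ i, s * a i * u i ≤ 2 * (Fintype.card ι * ε) :=
    sub_sum_mul_truncatedVertex_le hε.le k₀ (g := fun i => s * a i) fun i => by
      rw [abs_mul, abs_of_nonneg (ha0 i)]
      exact mul_le_one₀ hs (ha0 i) (ha1 i)
  have hright : ∑ k, p.1 k * (hybridDivergence η c u p -
      hybridDivergence η c u (mirrorStep hε η c p (g k)) + η * ∑ i, p.1 i * g k i ^ 2) =
      hybridDivergence η c u p -
        ∑ k, p.1 k * hybridDivergence η c u (mirrorStep hε η c p (g k)) +
        η * ∑ k, p.1 k * ∑ i, p.1 i * g k i ^ 2 := by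
    simp only [mul_add, mul_sub, Finset.sum_add_distrib, Finset.sum_sub_distrib,
      ← Finset.sum_mul, p.2.2, one_mul, Finset.mul_sum (a := η), mul_left_comm η]
  rw [hleft, hright] at hsum
  have := mul_le_mul_of_nonneg_left hvar hη.le
  linarith

end MirrorDescent

/-! ### Expectations of bounded functions under discrete distributions. -/

section Expectation

variable {α β : Type*}

theorem expectation_pure (a : α) (f : α → ℝ) : expectation (PMF.pure a) f = f a := by
  classical
  unfold expectation
  rw [tsum_eq_single a fun b hb => by simp [PMF.pure_apply, hb]]
  simp

theorem hasSum_pmf_toReal (p : PMF α) : HasSum (fun a => (p a).toReal) 1 := by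
  have h := (ENNReal.summable_toReal p.tsum_coe_ne_top).hasSum
  rwa [← ENNReal.tsum_toReal_eq p.apply_ne_top, p.tsum_coe, ENNReal.toReal_one] at h

theorem expectation_const (p : PMF α) (c : ℝ) : expectation p (fun _ => c) = c := by
  unfold expectation
  rw [tsum_mul_right, (hasSum_pmf_toReal p).tsum_eq, one_mul]

theorem expectation_mono {p : PMF α} {f g : α → ℝ} {B C : ℝ} (hf : ∀ a, |f a| ≤ B)
    (hg : ∀ a, |g a| ≤ C) (h : ∀ a, f a ≤ g a) : expectation p f ≤ expectation p g :=
  (summable_expectation p f B hf).tsum_le_tsum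
    (fun a => mul_le_mul_of_nonneg_left (h a) ENNReal.toReal_nonneg)
    (summable_expectation p g C hg)

theorem expectation_add {p : PMF α} {f g : α → ℝ} {B C : ℝ} (hf : ∀ a, |f a| ≤ B)
    (hg : ∀ a, |g a| ≤ C) :
    expectation p (fun a => f a + g a) = expectation p f + expectation p g := by
  unfold expectation
  simp only [mul_add]
  exact (summable_expectation p f B hf).tsum_add (summable_expectation p g C hg)

theorem abs_expectation_le {p : PMF α} {f : α → ℝ} {B : ℝ} (hf : ∀ a, |f a| ≤ B) :
    |expectation p f| ≤ B := by
  have hB : ∀ c : ℝ, |c| ≤ B → ∀ _ : α, |c| ≤ B := fun _ h _ => h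
  obtain ⟨a⟩ : Nonempty α := ⟨p.support_nonempty.some⟩
  have hB0 : 0 ≤ B := (abs_nonneg _).trans (hf a)
  refine abs_le.2 ⟨?_, ?_⟩
  · rw [← expectation_const p (-B)]
    exact expectation_mono (hB _ (by rw [abs_neg, abs_of_nonneg hB0])) hf
      fun a => (abs_le.1 (hf a)).1
  · rw [← expectation_const p B]
    exact expectation_mono hf (hB _ (abs_of_nonneg hB0).le) fun a => (abs_le.1 (hf a)).2

theorem expectation_bind (p : PMF α) (f : α → PMF β) {g : β → ℝ} {B : ℝ} (hg : ∀ b, |g b| ≤ B) :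
    expectation (p.bind f) g = expectation p fun a => expectation (f a) g := by
  have hsum : Summable fun x : α × β => (p x.1).toReal * (f x.1 x.2).toReal := by
    have h0 : ∀ x : α × β, 0 ≤ (p x.1).toReal * (f x.1 x.2).toReal :=
      fun x => mul_nonneg ENNReal.toReal_nonneg ENNReal.toReal_nonneg
    have h1 : ∀ a, HasSum (fun b => (p a).toReal * (f a b).toReal) (p a).toReal := fun a => by
      have h := (hasSum_pmf_toReal (f a)).mul_left (p a).toReal
      rwa [mul_one] at h
    rw [summable_prod_of_nonneg h0]
    refine ⟨fun a => (h1 a).summable, ?_⟩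
    have h2 : (fun a => ∑' b, (p a).toReal * (f a b).toReal) = fun a => (p a).toReal :=
      funext fun a => (h1 a).tsum_eq
    exact h2 ▸ (hasSum_pmf_toReal p).summable
  have hsum' : Summable fun x : α × β => (p x.1).toReal * (f x.1 x.2).toReal * g x.2 := by
    refine Summable.of_norm_bounded (hsum.mul_right B) fun x => ?_
    have h0 : 0 ≤ (p x.1).toReal * (f x.1 x.2).toReal :=
      mul_nonneg ENNReal.toReal_nonneg ENNReal.toReal_nonneg
    rw [Real.norm_eq_abs, abs_mul, abs_of_nonneg h0]
    exact mul_le_mul_of_nonneg_left (hg _) h0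
  unfold expectation
  calc ∑' b, (p.bind f b).toReal * g b
      = ∑' b, ∑' a, (p a).toReal * (f a b).toReal * g b := by
        refine tsum_congr fun b => ?_
        rw [PMF.bind_apply, ENNReal.tsum_toReal_eq
          fun a => ENNReal.mul_ne_top (p.apply_ne_top a) ((f a).apply_ne_top b), ← tsum_mul_right]
        simp only [ENNReal.toReal_mul]
    _ = ∑' a, ∑' b, (p a).toReal * (f a b).toReal * g b := Summable.tsum_comm hsum'
    _ = ∑' a, (p a).toReal * ∑' b, (f a b).toReal * g b := by
        simp only [mul_assoc, tsum_mul_left]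

theorem expectation_map (p : PMF α) (f : α → β) {g : β → ℝ} {B : ℝ} (hg : ∀ b, |g b| ≤ B) :
    expectation (p.map f) g = expectation p fun a => g (f a) := by
  rw [← PMF.bind_pure_comp, expectation_bind p _ hg]
  simp only [Function.comp, expectation_pure]

end Expectation

/-! ### The interaction protocol and the potential argument. -/

section Protocol

variable {X : Type*} {z : (X → Label) → X → X} {L : Learner X} {A : Adversary X}

theorem expectation_nextRound (past : List (Round X)) {f : Round X → ℝ} {B : ℝ}
    (hf : ∀ r, |f r| ≤ B) :
    expectation (nextRound z L A past) f = expectation (A past) fun a =>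
      expectation (L (past.map (Round.observe z))) fun h => f ⟨h, a⟩ := by
  unfold nextRound
  rw [expectation_bind _ _ hf]
  simp only [expectation_map _ _ hf]

theorem expectation_historyLaw_succ (t : ℕ) {f : List (Round X) → ℝ} {B : ℝ}
    (hf : ∀ l, |f l| ≤ B) :
    expectation (historyLaw z L A (t + 1)) f = expectation (historyLaw z L A t) fun past =>
      expectation (nextRound z L A past) fun r => f (r :: past) := by
  rw [historyLaw, expectation_bind _ _ hf]
  simp only [expectation_map _ _ hf]

/-- A bounded potential whose expected decrease pays for all but `κ` of the expected cost of each
round bounds the total expected cost. -/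
theorem sum_expectation_roundLaw_le {f : Round X → ℝ} {Φ : List (Round X) → ℝ} {B C κ : ℝ}
    (hf : ∀ r, |f r| ≤ B) (hΦ : ∀ l, |Φ l| ≤ C) (hΦ0 : ∀ l, 0 ≤ Φ l)
    (h : ∀ past, expectation (nextRound z L A past) (fun r => f r + Φ (r :: past)) ≤ Φ past + κ)
    (T : ℕ) :
    ∑ t ∈ Finset.range T, expectation (roundLaw z L A t) f ≤ Φ [] + T * κ := by
  have step : ∀ t, expectation (roundLaw z L A t) f + expectation (historyLaw z L A (t + 1)) Φ ≤
      expectation (historyLaw z L A t) Φ + κ := by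
    intro t
    have hκ : ∀ _ : List (Round X), |κ| ≤ |κ| := fun _ => le_rfl
    rw [roundLaw, expectation_bind _ _ hf, expectation_historyLaw_succ t hΦ,
      ← expectation_add (fun _ => abs_expectation_le hf) fun _ => abs_expectation_le fun _ => hΦ _,
      ← expectation_const (historyLaw z L A t) κ, ← expectation_add hΦ hκ]
    refine expectation_mono (B := B + C) (C := C + |κ|) (fun l => ?_) (fun l => ?_) fun past => ?_
    · exact (abs_add_le _ _).trans
        (add_le_add (abs_expectation_le hf) (abs_expectation_le fun _ => hΦ _))
    · exact (abs_add_le _ _).trans (add_le_add (hΦ l) le_rfl)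
    · rw [← expectation_add hf fun _ => hΦ _]
      exact h past
  have main : ∀ t, ∑ s ∈ Finset.range t, expectation (roundLaw z L A s) f +
      expectation (historyLaw z L A t) Φ ≤ Φ [] + t * κ := by
    intro t
    induction t with
    | zero => simp [historyLaw, expectation_pure]
    | succ t ih =>
      rw [Finset.sum_range_succ]
      push_cast
      linarith [step t]
  have h0 : 0 ≤ expectation (historyLaw z L A T) Φ :=
    tsum_nonneg fun l => mul_nonneg ENNReal.toReal_nonneg (hΦ0 l)
  linarith [main T]

theorem abs_strategicLoss_sub_le (h h' : X → Label) (a : Agent X) :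
    |strategicLoss z h a - strategicLoss z h' a| ≤ 1 := by
  unfold strategicLoss
  split_ifs <;> simp

theorem expectedRegret_le {H : Finset (X → Label)} {hH : H.Nonempty} {T : ℕ} :
    expectedRegret z H hH L A T ≤ T := by
  refine Finset.sup'_le _ _ fun h _ => ?_
  refine (Finset.sum_le_card_nsmul _ _ 1 fun t _ => ?_).trans_eq (by simp)
  exact (abs_le.1 (abs_expectation_le fun r => abs_strategicLoss_sub_le _ _ _)).2

theorem expectedRegret_pure_singleton (h : X → Label) (T : ℕ) :
    expectedRegret z {h} (Finset.singleton_nonempty h) (fun _ => PMF.pure h) A T = 0 := by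
  have hb : ∀ r : Round X,
      |strategicLoss z r.classifier r.agent - strategicLoss z h r.agent| ≤ 1 :=
    fun r => abs_strategicLoss_sub_le _ _ _
  unfold expectedRegret
  rw [Finset.sup'_singleton]
  refine Finset.sum_eq_zero fun t _ => ?_
  rw [roundLaw, expectation_bind _ _ hb]
  simp only [expectation_nextRound _ hb, expectation_pure, sub_self, expectation_const]

end Protocol

/-! ### The learner and its regret. -/

section HybridLearner

variable {X : Type*}

open Classical in
/-- The indicator that an agent at `x` is classified as negative by `h`, after manipulation. -/
noncomputable def rejection (G : Digraph X) (h : X → Label) (x : X) : ℝ :=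
  if bestResponses G h x = ∅ then 1 else 0

theorem rejection_eq_zero_or_one (G : Digraph X) (h : X → Label) (x : X) :
    rejection G h x = 0 ∨ rejection G h x = 1 := by
  unfold rejection
  split_ifs <;> simp

theorem IsManipulationRule.apply_eq_one_iff {G : Digraph X} {z : (X → Label) → X → X}
    (hz : IsManipulationRule G z) (h : X → Label) (x : X) :
    h (z h x) = 1 ↔ bestResponses G h x ≠ ∅ := by
  by_cases hc : bestResponses G h x = ∅ ∨ x ∈ bestResponses G h x
  · rw [(hz h x).1 hc]
    refine ⟨fun h1 h2 => ?_, fun h1 => (hc.resolve_left h1).2⟩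
    have : x ∈ bestResponses G h x := ⟨Or.inl rfl, h1⟩
    rw [h2] at this
    exact this
  · have h1 := (hz h x).2 hc
    exact ⟨fun _ h2 => hc (Or.inl h2), fun _ => h1.2⟩

theorem IsManipulationRule.strategicLoss_eq {G : Digraph X} {z : (X → Label) → X → X}
    (hz : IsManipulationRule G z) (h : X → Label) (a : Agent X) :
    strategicLoss z h a = (1 - ((a.2 : ℤ) : ℝ)) / 2 - -((a.2 : ℤ) : ℝ) * rejection G h a.1 := by
  have h1 := hz.apply_eq_one_iff h a.1
  unfold strategicLoss rejection
  rcases Int.units_eq_one_or a.2 with hy | hy <;>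
    rcases Int.units_eq_one_or (h (z h a.1)) with hh | hh <;> rw [hh] at h1 ⊢ <;> rw [hy]
  · simp [h1.1 rfl]
  · have : bestResponses G h a.1 = ∅ := by
      by_contra h2
      exact absurd (h1.2 h2) (by decide)
    simp [this]
  · have := h1.1 rfl
    norm_num [this]
  · have : bestResponses G h a.1 = ∅ := by
      by_contra h2
      exact absurd (h1.2 h2) (by decide)
    norm_num [this]

variable {H : Finset (X → Label)}

/-- Importance weighted estimate of the gains, from the observation of one round. The feature is
used only if the sampled classifier rejects, in which case it is the true one. -/
noncomputable def gainEstimate (G : Digraph X) (p : H → ℝ) (o : Observation X) (h : H) : ℝ :=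
  if o.classifier o.feature = 1 then 0 else
    rejection G h.1 o.feature *
      (-((o.label : ℤ) : ℝ) / ∑ k, p k * rejection G k.1 o.feature)

/-- A rejected agent stays put, so the observed feature is `a.1` whenever the estimate uses it.
Hence the tie-breaking rule disappears from the estimate. -/
theorem IsManipulationRule.gainEstimate_eq {G : Digraph X} {z : (X → Label) → X → X}
    (hz : IsManipulationRule G z) (p : H → ℝ) (k : X → Label) (a : Agent X) (h : H) :
    gainEstimate G p (Round.observe z ⟨k, a⟩) h = rejection G k a.1 * (rejection G h.1 a.1 *
      (-((a.2 : ℤ) : ℝ) / ∑ k, p k * rejection G k.1 a.1)) := by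
  have h1 := hz.apply_eq_one_iff k a.1
  unfold gainEstimate Round.observe
  by_cases hb : bestResponses G k a.1 = ∅
  · have h2 : rejection G k a.1 = 1 := by simp [rejection, hb]
    have h3 : ¬ k (z k a.1) = 1 := fun h => h1.1 h hb
    rw [h2, one_mul, if_neg h3, (hz k a.1).1 (Or.inl hb)]
  · have h2 : rejection G k a.1 = 0 := by simp [rejection, hb]
    rw [h2, zero_mul, if_pos (h1.2 hb)]

/-- The weights of the hybrid mirror descent learner. -/
noncomputable def hybridWeights (G : Digraph X) {ε : ℝ} (hε : 0 < ε) (η c : ℝ)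
    (p₀ : truncatedSimplex H ε) : List (Observation X) → truncatedSimplex H ε
  | [] => p₀
  | o :: l => mirrorStep hε η c (hybridWeights G hε η c p₀ l)
      (gainEstimate G (hybridWeights G hε η c p₀ l).1 o)

/-- The distribution with the given weights. -/
noncomputable def simplexPMF {ι : Type*} [Fintype ι] {ε : ℝ} (hε : 0 < ε)
    (p : truncatedSimplex ι ε) : PMF ι :=
  PMF.ofFintype (fun i => ENNReal.ofReal (p.1 i)) (by
    rw [← ENNReal.ofReal_sum_of_nonneg fun i _ => hε.le.trans (p.2.1 i), p.2.2,
      ENNReal.ofReal_one])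

theorem expectation_simplexPMF {ι : Type*} [Fintype ι] {ε : ℝ} (hε : 0 < ε)
    (p : truncatedSimplex ι ε) (f : ι → ℝ) :
    expectation (simplexPMF hε p) f = ∑ i, p.1 i * f i := by
  unfold expectation simplexPMF
  rw [tsum_fintype]
  refine Finset.sum_congr rfl fun i _ => ?_
  rw [PMF.ofFintype_apply, ENNReal.toReal_ofReal (hε.le.trans (p.2.1 i))]

/-- The hybrid mirror descent learner. -/
noncomputable def hybridLearner (G : Digraph X) {ε : ℝ} (hε : 0 < ε) (η c : ℝ)
    (p₀ : truncatedSimplex H ε) : Learner X :=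
  fun o => (simplexPMF hε (hybridWeights G hε η c p₀ o)).map Subtype.val

theorem hybridLearner_isProper (G : Digraph X) {ε : ℝ} (hε : 0 < ε) (η c : ℝ)
    (p₀ : truncatedSimplex H ε) : (hybridLearner G hε η c p₀).IsProper H := by
  intro o h hh
  rw [hybridLearner, PMF.support_map] at hh
  obtain ⟨k, -, rfl⟩ := hh
  exact k.2

/-- The first two terms bound the initial divergence from the uniform weights; the last collects,
over all rounds, the second moment and the smoothing of the comparator. -/
theorem exists_learner_expectedRegret_le (G : Digraph X) (hH : H.Nonempty) {ε η c : ℝ}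
    (hε : 0 < ε) (hη : 0 < η) (hc : 0 ≤ c) (hpar : 2 ≤ c ∨ η ≤ ε) (hn : H.card * ε ≤ 1) :
    ∃ L : Learner X, L.IsProper H ∧ ∀ z, IsManipulationRule G z → ∀ (A : Adversary X) (T : ℕ),
      expectedRegret z H hH L A T ≤ Real.log H.card / η + c * (H.card * Real.log (1 / ε)) +
        T * (η + 2 * (H.card * ε)) := by
  classical
  have : Nonempty H := hH.to_subtype
  rw [← Fintype.card_coe H] at hn ⊢
  let p₀ : truncatedSimplex H ε := ⟨_, uniform_mem_truncatedSimplex hn⟩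
  refine ⟨hybridLearner G hε η c p₀, hybridLearner_isProper G hε η c p₀, fun z hz A T => ?_⟩
  refine Finset.sup'_le _ _ fun h hh => ?_
  have hf : ∀ r : Round X,
      |strategicLoss z r.classifier r.agent - strategicLoss z h r.agent| ≤ 1 :=
    fun r => abs_strategicLoss_sub_le _ _ _
  have hu := truncatedVertex_mem hn (⟨h, hh⟩ : H)
  set u := truncatedVertex ε (⟨h, hh⟩ : H)
  obtain ⟨B, hB⟩ := abs_hybridDivergence_le (η := η) (c := c) hε hu
  let Φ : List (Round X) → ℝ := fun past =>
    hybridDivergence η c u (hybridWeights G hε η c p₀ (past.map (Round.observe z)))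
  have hΦ : ∀ l, |Φ l| ≤ B := fun l => hB _
  refine (sum_expectation_roundLaw_le (Φ := Φ) (κ := η + 2 * (Fintype.card H * ε)) hf hΦ
    (fun l => Finset.sum_nonneg fun i _ => hybridDiv_nonneg hη hc (hε.trans_le (hu.1 i))
      (hε.trans_le ((hybridWeights G hε η c p₀ _).2.1 i))) (fun past => ?_) T).trans
    (add_le_add (hybridDivergence_uniform_le hε hη hc hu) le_rfl)
  have hfΦ : ∀ r : Round X, |strategicLoss z r.classifier r.agent - strategicLoss z h r.agent +
      Φ (r :: past)| ≤ 1 + B := fun r => (abs_add_le _ _).trans (add_le_add (hf r) (hΦ _))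
  rw [expectation_nextRound past hfΦ,
    ← expectation_const (A past) (Φ past + (η + 2 * (Fintype.card H * ε)))]
  refine expectation_mono (fun a => abs_expectation_le fun k => hfΦ _) (fun _ => le_rfl) fun a => ?_
  set p := hybridWeights G hε η c p₀ (past.map (Round.observe z)) with hp
  have hs : |-((a.2 : ℤ) : ℝ)| ≤ 1 := by
    rcases Int.units_eq_one_or a.2 with hy | hy <;> simp [hy]
  have key := expected_mirrorStep_le hε hη hc hpar hn p ⟨h, hh⟩
    (a := fun k => rejection G k.1 a.1) (fun k => rejection_eq_zero_or_one G k.1 a.1) hs rfl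
    (fun k => gainEstimate G p.1 (Round.observe z ⟨k.1, a⟩))
    fun k i => hz.gainEstimate_eq p.1 k.1 a i
  refine le_of_eq_of_le ?_ key
  rw [hybridLearner, expectation_map _ _ fun k => hfΦ ⟨k, a⟩, ← hp, expectation_simplexPMF]
  have hΦ' : ∀ k : H, Φ (⟨k.1, a⟩ :: past) = hybridDivergence η c u
      (mirrorStep hε η c p (gainEstimate G p.1 (Round.observe z ⟨k.1, a⟩))) := fun k => rfl
  simp only [hΦ', hz.strategicLoss_eq, mul_add, mul_sub, Finset.sum_add_distrib,
    Finset.sum_sub_distrib, ← Finset.sum_mul, p.2.2]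
  ring

/-- Regret with the logarithmic barrier. -/
theorem exists_learner_barrier (G : Digraph X) (hH : H.Nonempty) (hcard : 2 ≤ H.card) {T : ℕ}
    (hT : 1 ≤ T) :
    ∃ L : Learner X, L.IsProper H ∧ ∀ z, IsManipulationRule G z → ∀ A : Adversary X,
      expectedRegret z H hH L A T ≤ 4 * (Real.sqrt (T * Real.log H.card) +
        H.card * Real.log (H.card * T)) := by
  set n : ℝ := (H.card : ℝ) with hn
  have hn2 : (2 : ℝ) ≤ n := Nat.ofNat_le_cast.2 hcard
  have hT1 : (1 : ℝ) ≤ T := by exact_mod_cast hT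
  have hlog : 0 < Real.log n := Real.log_pos (by linarith)
  set S := Real.sqrt (T * Real.log n)
  have hS0 : 0 < S := Real.sqrt_pos.2 (by positivity)
  have hSS : S * S = T * Real.log n := Real.mul_self_sqrt (by positivity)
  -- This `ε` makes the total smoothing cost 2, and `η = S / T` balances `log n / η` with `T η`.
  have hε : 0 < 1 / (n * T) := by positivity
  have hη : 0 < S / T := by positivity
  have hnT : n * (1 / (n * T)) * T = 1 := by field_simp
  have hle : n * (1 / (n * T)) ≤ 1 := by
    have h0 : 0 ≤ n * (1 / (n * T)) := by positivity
    nlinarith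
  obtain ⟨L, hL, h⟩ := exists_learner_expectedRegret_le G hH hε hη zero_le_two (Or.inl le_rfl) hle
  refine ⟨L, hL, fun z hz A => (h z hz A T).trans ?_⟩
  have e1 : Real.log n / (S / T) = S := by
    rw [div_div_eq_mul_div, mul_comm, ← hSS, mul_self_div_self]
  have e2 : (T : ℝ) * (S / T + 2 * (n * (1 / (n * T)))) = S + 2 := by
    have : (T : ℝ) * (S / T) = S := by field_simp
    linarith
  have h1 : 1 ≤ n * Real.log (n * T) := by
    have : Real.log 2 ≤ Real.log (n * T) := Real.log_le_log two_pos (by nlinarith)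
    nlinarith [Real.log_two_gt_d9]
  rw [← hn, e1, e2, one_div_one_div]
  linarith

/-- Regret without the logarithmic barrier. -/
theorem exists_learner_entropy (G : Digraph X) (hH : H.Nonempty) (hcard : 2 ≤ H.card) {T : ℕ}
    (hT : 1 ≤ T) (hlarge : H.card * Real.log H.card ≤ T) :
    ∃ L : Learner X, L.IsProper H ∧ ∀ z, IsManipulationRule G z → ∀ A : Adversary X,
      expectedRegret z H hH L A T ≤ 4 * Real.sqrt (T * H.card * Real.log H.card) := by
  set n : ℝ := (H.card : ℝ) with hn
  have hn2 : (2 : ℝ) ≤ n := Nat.ofNat_le_cast.2 hcard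
  have hT1 : (1 : ℝ) ≤ T := by exact_mod_cast hT
  have hlog : 0 < Real.log n := Real.log_pos (by linarith)
  set S := Real.sqrt (T * n * Real.log n)
  have hS0 : 0 < S := Real.sqrt_pos.2 (by positivity)
  have hSS : S * S = T * n * Real.log n := Real.mul_self_sqrt (by positivity)
  have hST : S ≤ T := by
    refine Real.sqrt_le_iff.2 ⟨by linarith, ?_⟩
    nlinarith
  -- Used for both `η` and `ε`, with `c = 0`. The floor dominates the cost, so `log n / η` is
  -- balanced with `T n η`.
  have hη : 0 < S / (n * T) := by positivity
  have hnη : n * (S / (n * T)) = S / T := by field_simp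
  have hle : n * (S / (n * T)) ≤ 1 := by
    rw [hnη]
    exact div_le_one_of_le₀ hST (by linarith)
  obtain ⟨L, hL, h⟩ := exists_learner_expectedRegret_le G hH hη hη le_rfl (Or.inr le_rfl) hle
  refine ⟨L, hL, fun z hz A => (h z hz A T).trans ?_⟩
  have e1 : Real.log n / (S / (n * T)) = S := by
    rw [div_div_eq_mul_div, mul_comm, mul_comm n, ← hSS, mul_self_div_self]
  have e2 : (T : ℝ) * (S / (n * T)) = S / n := by field_simp
  have e3 : (T : ℝ) * (S / T) = S := by field_simp
  have e4 : S / n ≤ S := div_le_self hS0.le (by linarith)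
  rw [← hn, e1, hnη, zero_mul, mul_add, e2]
  linarith

end HybridLearner

end StrategicOnline

theorem mainTheorem8 :
    ∃ C : ℝ, 0 < C ∧
      ∀ (X : Type*) (G : Digraph X) (H : Finset (X → StrategicOnline.Label)) (hH : H.Nonempty)
        (n T : ℕ), H.card = n → 1 ≤ T →
        ∃ L : StrategicOnline.Learner X, L.IsProper H ∧
          ∀ z : (X → StrategicOnline.Label) → X → X, StrategicOnline.IsManipulationRule G z →
            ∀ A : StrategicOnline.Adversary X,
              StrategicOnline.expectedRegret z H hH L A T ≤
                C * min
                  (Real.sqrt ((T : ℝ) * Real.log (n : ℝ)) + (n : ℝ) * Real.log ((n : ℝ) * (T : ℝ)))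
                  (Real.sqrt ((T : ℝ) * (n : ℝ) * Real.log (n : ℝ))) := by
  refine ⟨4, by norm_num, fun X G H hH n T hn hT => ?_⟩
  subst hn
  rcases Nat.lt_or_ge H.card 2 with hcard | hcard
  -- For `n = 1` the minimum is 0, so the regret must vanish exactly.
  · obtain ⟨h, rfl⟩ : ∃ h, H = {h} :=
      Finset.card_eq_one.1 (le_antisymm (Nat.lt_succ_iff.1 hcard) hH.card_pos)
    refine ⟨fun _ => PMF.pure h, fun o => by simp, fun z hz A => ?_⟩
    rw [StrategicOnline.expectedRegret_pure_singleton]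
    have hT0 : 0 ≤ Real.log T := Real.log_natCast_nonneg T
    simp [hT0]
  rcases le_total (Real.sqrt ((T : ℝ) * Real.log (H.card : ℝ)) +
      (H.card : ℝ) * Real.log ((H.card : ℝ) * (T : ℝ)))
    (Real.sqrt ((T : ℝ) * (H.card : ℝ) * Real.log (H.card : ℝ))) with hmin | hmin
  · rw [min_eq_left hmin]
    exact StrategicOnline.exists_learner_barrier G hH hcard hT
  rw [min_eq_right hmin]
  rcases le_total ((H.card : ℝ) * Real.log (H.card : ℝ)) T with hlarge | hlarge
  · exact StrategicOnline.exists_learner_entropy G hH hcard hT hlarge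
  obtain ⟨h, hh⟩ := hH
  -- When `T ≤ n log n`, the trivial bound `T` is already below the target, and any fixed classifier
  -- will do.
  refine ⟨fun _ => PMF.pure h, fun o => by simpa using hh, fun z hz A => ?_⟩
  have hle : (T : ℝ) ≤ Real.sqrt ((T : ℝ) * (H.card : ℝ) * Real.log (H.card : ℝ)) := by
    refine Real.le_sqrt_of_sq_le ?_
    have hT0 : (0 : ℝ) ≤ T := Nat.cast_nonneg T
    nlinarith
  refine StrategicOnline.expectedRegret_le.trans (hle.trans ?_)
  linarith [Real.sqrt_nonneg ((T : ℝ) * (H.card : ℝ) * Real.log (H.card : ℝ))]
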